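/- Let $p\ge 1$ be an integer. There is a constant $C_p>0$ depending only on $p$ such that the following holds. Let $d\ge 1$ and $n\ge 2$ be integers and let $\Sigma\in\mathbb{R}^{d\times d}$ be symmetric positive definite, with largest eigenvalue $\sigma_1^2$ ($\sigma_1>0$) and effective dimension $d_{\mathrm{eff}}=\operatorname{Tr}(\Sigma)/\sigma_1^2$. A random vector $X\in\mathbb{R}^d$ is called $\Sigma$-subgaussian if $\mathbb{P}(|X^\top x|>t)\le 2\exp\big(-\tfrac12\, t^2/(x^\top\Sigma x)\big)$ for all $t>0$ and all nonzero $x\in\mathbb{R}^d$ with $\|x\|\le 1$. Let $T_1,\dots,T_n$ be i.i.d. random tensors of order $p$ on $\mathbb{R}^d$, each of the form $T_i=X_i^{\otimes p}$ with $X_i$ a $\Sigma$-subgaussian random vector, and let $T=\frac1n\sum_{i=1}^nT_i$. For a tensor $A$ of order $p$ put $$\|A\|_{\mathrm{op}}=\sup_{\|x_1\otimes\cdots\otimes x_p\|\le 1}\langle A,x_1\otimes\cdots\otimes x_p\rangle,$$ where $\langle A,B\rangle=\sum_{i_1,\dots,i_p}A_{i_1\dots i_p}B_{i_1\dots i_p}$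 and $\|A\|^2=\langle A,A\rangle$. Then the entries of the $T_i$ are integrable, and for every $\delta>0$, with probability at least $1-\delta$, $$\|T-\mathbb{E}T\|_{\mathrm{op}}\le C_p\,\sigma_1^p\sqrt{\frac{\big(d_{\mathrm{eff}}+\ln d+\ln(\delta^{-1})\big)^{p+1}\ln(n)^p}{n}}$$ (for $\delta\ge 1$ this says nothing). Equivalently, with the same constant $C_p$, for every $\lambda>0$, $$\mathbb{P}\left(\|T-\mathbb{E}T\|_{\mathrm{op}}\ge C_p\,\sigma_1^p\sqrt{\frac{\big(d_{\mathrm{eff}}+\ln d+\lambda\big)^{p+1}\ln(n)^p}{n}}\right)\le e^{-\lambda}.$$ -/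

import Mathlib

open MeasureTheory ProbabilityTheory

open scoped Matrix

noncomputable section

/-- Real tensors of order `p` on `ℝ^d`: arrays indexed by `p`-tuples of coordinates. -/
abbrev Tensor (p d : ℕ) : Type := (Fin p → Fin d) → ℝ

namespace Tensor

variable {p d : ℕ}

/-- The entrywise scalar product of two tensors. -/
def scalarProd (T S : Tensor p d) : ℝ := ∑ J, T J * S J

/-- The Euclidean (Frobenius) norm of a tensor. -/
def frobNorm (T : Tensor p d) : ℝ := Real.sqrt (∑ J, T J ^ 2)

/-- The elementary tensor `x₁ ⊗ ⋯ ⊗ x_p`. -/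
def outer (x : Fin p → EuclideanSpace ℝ (Fin d)) : Tensor p d :=
  fun J => ∏ k, x k (J k)

/-- The symmetric rank-one tensor `x ⊗ ⋯ ⊗ x` with `p` factors. -/
def power (p : ℕ) (x : EuclideanSpace ℝ (Fin d)) : Tensor p d :=
  outer fun _ => x

/-- The operator norm: the supremum of `⟨T, x₁ ⊗ ⋯ ⊗ x_p⟩` over `‖x₁ ⊗ ⋯ ⊗ x_p‖ ≤ 1`. -/
def opNorm (T : Tensor p d) : ℝ :=
  sSup {r : ℝ | ∃ x : Fin p → EuclideanSpace ℝ (Fin d),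
    frobNorm (outer x) ≤ 1 ∧ r = scalarProd T (outer x)}

/-- The set whose supremum is the operator norm is bounded, so that supremum is a genuine one. -/
theorem bddAbove_opNorm_set (T : Tensor p d) :
    BddAbove {r : ℝ | ∃ x : Fin p → EuclideanSpace ℝ (Fin d),
      frobNorm (outer x) ≤ 1 ∧ r = scalarProd T (outer x)} := by
  refine ⟨frobNorm T, ?_⟩
  rintro r ⟨x, hx, rfl⟩
  calc scalarProd T (outer x) ≤ frobNorm T * frobNorm (outer x) :=
        Real.sum_mul_le_sqrt_mul_sqrt _ _ _
    _ ≤ frobNorm T * 1 := mul_le_mul_of_nonneg_left hx (Real.sqrt_nonneg _)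
    _ = frobNorm T := mul_one _

/-- The empirical mean `(1/n) ∑ T_i` of `n` random tensors. -/
def empiricalMean {Ω : Type*} {n : ℕ} (T : Fin n → Ω → Tensor p d) (ω : Ω) : Tensor p d :=
  fun J => (1 / (n : ℝ)) * ∑ i, T i ω J

/-- The expectation of a random tensor, entry by entry. -/
def expectation {Ω : Type*} [MeasurableSpace Ω] (μ : Measure Ω) (T : Ω → Tensor p d) :
    Tensor p d :=
  fun J => ∫ ω, T ω J ∂μ

end Tensor

/-- A random vector `a` is `S`-subgaussian if
`P(|aᵀx| > t) ≤ 2 exp(-t² / (2 xᵀSx))` for all `t > 0` and all `x` in the unit ball. -/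
def IsSubgaussianVec {d : ℕ} {Ω : Type*} [MeasurableSpace Ω] (S : Matrix (Fin d) (Fin d) ℝ)
    (a : Ω → EuclideanSpace ℝ (Fin d)) (μ : Measure Ω) : Prop :=
  Measurable a ∧ ∀ t : ℝ, 0 < t → ∀ x : EuclideanSpace ℝ (Fin d), ‖x‖ ≤ 1 →
    μ.real {ω | t < |inner ℝ (a ω) x|} ≤
      2 * Real.exp (-(1 / 2) * (t ^ 2 / (x.ofLp ⬝ᵥ (S *ᵥ x.ofLp))))

/-- A symmetric random tensor of rank one that is `S`-subgaussian: `T = X ⊗ ⋯ ⊗ X` for some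
`S`-subgaussian random vector `X`. -/
def IsSymmRankOneSubgaussian {p d : ℕ} {Ω : Type*} [MeasurableSpace Ω]
    (S : Matrix (Fin d) (Fin d) ℝ) (T : Ω → Tensor p d) (μ : Measure Ω) : Prop :=
  ∃ X : Ω → EuclideanSpace ℝ (Fin d), IsSubgaussianVec S X μ ∧ ∀ ω, T ω = Tensor.power p (X ω)

/-- `σ₁`, where `σ₁²` is the largest eigenvalue of the positive-definite matrix `S`. -/
def sigmaOne {d : ℕ} {S : Matrix (Fin d) (Fin d) ℝ} (hS : S.PosDef) : ℝ :=
  Real.sqrt (⨆ i, hS.1.eigenvalues i)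

/-- The effective dimension `Tr S / σ₁²`. -/
def effDim {d : ℕ} {S : Matrix (Fin d) (Fin d) ℝ} (hS : S.PosDef) : ℝ :=
  S.trace / sigmaOne hS ^ 2

end

/-! The operator norm is at most the Frobenius norm, so it suffices to bound a sum of independent
centered vectors in a Hilbert space. The Frobenius norm of `X^{⊗p}` is `‖X‖ ^ p`, so everything
reduces to the tail of `‖X‖`.

That tail comes from Gaussian randomization. For a standard Gaussian `G`, `exp (‖x‖² / (8σ₁²))` is
the mean of `exp ⟨x, G / (2σ₁)⟩`. Exchanging the two expectations leaves the Laplace transform of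
`X` in a fixed direction, which is subgaussian, and then a Gaussian quadratic form with total weight
`d_eff / 4`. Hence `E exp (‖X‖² / (8σ₁²)) ≤ 3 exp (d_eff / 2)` (`lintegral_exp_norm_sq_le`).

Now truncate `‖X‖` at `R`, where `R² = 8σ₁²K` and `K = d_eff/2 + ln n + λ + ln 8`. With this `K` all
`n` vectors stay below `R` up to probability `3e^{-λ}/8`, and truncation moves each mean by `O(R^p /
n)`. The truncated tensors obey a dimension-free Hoeffding inequality
(`measureReal_norm_sum_ge_le`), whose failure probability is made `e^{-λ}/2`. Finally `K ≤ 6 (d_eff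
+ λ) ln n` gives the stated form; the term `ln d` is only slack. -/

/-! ### Convexity of `cosh (s √w)` -/

theorem convexOn_cosh_mul_sqrt (s : ℝ) :
    ConvexOn ℝ (Set.Ici 0) fun w : ℝ => Real.cosh (s * √w) := by
  have key (w : ℝ) (hw : 0 ≤ w) :
      HasSum (fun k : ℕ => s ^ (2 * k) / (2 * k).factorial * w ^ k) (Real.cosh (s * √w)) := by
    convert Real.hasSum_cosh (s * √w) using 2 with k
    rw [mul_pow, pow_mul √w, Real.sq_sqrt hw]
    ring
  refine ⟨convex_Ici 0, fun x hx y hy a b ha hb hab => ?_⟩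
  have hx' : 0 ≤ x := hx
  have hy' : 0 ≤ y := hy
  simp only [smul_eq_mul]
  -- As a power series in `w` the function has nonnegative coefficients, so convexity holds term by
  -- term.
  refine hasSum_le (fun k => ?_) (key (a * x + b * y) (by positivity))
    (((key x hx').mul_left a).add ((key y hy').mul_left b))
  have h := (convexOn_pow k).2 hx hy ha hb hab
  simp only [smul_eq_mul] at h
  have hc : 0 ≤ s ^ (2 * k) / (2 * k).factorial := by
    rw [pow_mul]; positivity
  calc _ ≤ s ^ (2 * k) / (2 * k).factorial * (a * x ^ k + b * y ^ k) :=
        mul_le_mul_of_nonneg_left h hc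
    _ = _ := by ring

/-- The argument of the root is the convex combination of `(a + b)²` and `(a - b)²` with weights `(1
± t/(ab))/2`. The point is that the bound is affine in `t`: with `t = ⟨x, y⟩` the linear term
vanishes on averaging over a centered `y`. -/
theorem cosh_mul_sqrt_le (s : ℝ) {a b t : ℝ} (ha : 0 ≤ a) (hb : 0 ≤ b) (ht : |t| ≤ a * b) :
    Real.cosh (s * √(a ^ 2 + 2 * t + b ^ 2)) ≤
      Real.cosh (s * a) * Real.cosh (s * b) +
        Real.sinh (s * a) * Real.sinh (s * b) / (a * b) * t := by
  rcases (mul_nonneg ha hb).eq_or_lt with h0 | h0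
  · rw [← h0, abs_nonpos_iff] at ht
    rcases mul_eq_zero.1 h0.symm with rfl | rfl <;> simp [ht, Real.sqrt_sq, ha, hb]
  · obtain ⟨h1, h2⟩ := abs_le.1 ht
    have h3 : 0 ≤ (1 + t / (a * b)) / 2 := by
      have : -1 ≤ t / (a * b) := by rw [le_div_iff₀ h0]; linarith
      linarith
    have h4 : 0 ≤ (1 - t / (a * b)) / 2 := by
      have : t / (a * b) ≤ 1 := by rw [div_le_iff₀ h0]; linarith
      linarith
    have h := (convexOn_cosh_mul_sqrt s).2 (Set.mem_Ici.2 (sq_nonneg (a + b)))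
      (Set.mem_Ici.2 (sq_nonneg (a - b))) h3 h4 (by ring)
    simp only [smul_eq_mul] at h
    have e : (1 + t / (a * b)) / 2 * (a + b) ^ 2 + (1 - t / (a * b)) / 2 * (a - b) ^ 2 =
        a ^ 2 + 2 * t + b ^ 2 := by
      have : a ≠ 0 := by rintro rfl; simp at h0
      have : b ≠ 0 := by rintro rfl; simp at h0
      field_simp
      ring
    have e2 : Real.cosh (s * √((a - b) ^ 2)) = Real.cosh (s * (a - b)) := by
      rw [Real.sqrt_sq_eq_abs, ← Real.cosh_abs, abs_mul, abs_abs, ← abs_mul, Real.cosh_abs]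
    rw [e, e2, Real.sqrt_sq (by positivity), mul_add, mul_sub, Real.cosh_add, Real.cosh_sub] at h
    refine h.trans (le_of_eq ?_)
    ring

/-! ### Hoeffding's inequality in a Hilbert space -/

section Hoeffding

variable {E : Type*} [NormedAddCommGroup E] [InnerProductSpace ℝ E] [CompleteSpace E]
  [MeasurableSpace E] [BorelSpace E] [SecondCountableTopology E]

theorem integral_cosh_norm_add_le (ν : Measure E) [IsProbabilityMeasure ν] {b s : ℝ} (hs : 0 ≤ s)
    (hb : 0 ≤ b) (hν : ∀ᵐ y ∂ν, ‖y‖ ≤ b) (h0 : ∫ y, y ∂ν = 0) (x : E) :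
    ∫ y, Real.cosh (s * ‖x + y‖) ∂ν ≤ Real.cosh (s * ‖x‖) * Real.cosh (s * b) := by
  have hi : Integrable (fun y : E => y) ν :=
    Integrable.of_bound (by fun_prop) b hν
  set m := Real.sinh (s * ‖x‖) * Real.sinh (s * b) / (‖x‖ * b)
  have hi2 : Integrable (fun y : E => m * inner ℝ x y) ν := (hi.const_inner x).const_mul m
  calc ∫ y, Real.cosh (s * ‖x + y‖) ∂ν
      ≤ ∫ y, (Real.cosh (s * ‖x‖) * Real.cosh (s * b) + m * inner ℝ x y) ∂ν := by
        refine integral_mono_of_nonneg (.of_forall fun y => (Real.cosh_pos _).le)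
          ((integrable_const _).add hi2) ?_
        filter_upwards [hν] with y hy
        have ht : |inner ℝ x y| ≤ ‖x‖ * b :=
          (abs_real_inner_le_norm x y).trans (mul_le_mul_of_nonneg_left hy (norm_nonneg x))
        -- Replacing `‖y‖²` by `b²` under the root only increases the left side.
        refine le_trans ?_ (cosh_mul_sqrt_le s (norm_nonneg x) hb ht)
        rw [Real.cosh_le_cosh, abs_of_nonneg (by positivity), abs_of_nonneg (by positivity)]
        refine mul_le_mul_of_nonneg_left (Real.le_sqrt_of_sq_le ?_) hs
        rw [norm_add_sq_real]
        gcongr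
    _ = _ := by
        have h : ∫ y, m * inner ℝ x y ∂ν = 0 := by
          rw [integral_const_mul, integral_inner hi, h0, inner_zero_right, mul_zero]
        rw [integral_add (integrable_const _) hi2, h]
        simp

/-- By independence the law of (partial sum, new summand) is a product, so Fubini and the one-step
bound contribute a factor `cosh (s * b)` per summand. -/
theorem integral_cosh_norm_sum_le {Ω ι : Type*} [MeasurableSpace Ω] {μ : Measure Ω}
    [IsProbabilityMeasure μ] {Y : ι → Ω → E} (hm : ∀ i, Measurable (Y i)) (hind : iIndepFun Y μ)
    {b s : ℝ} (hs : 0 ≤ s) (hb : 0 ≤ b) (hY : ∀ i ω, ‖Y i ω‖ ≤ b) (h0 : ∀ i, ∫ ω, Y i ω ∂μ = 0)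
    (t : Finset ι) :
    ∫ ω, Real.cosh (s * ‖∑ i ∈ t, Y i ω‖) ∂μ ≤ Real.cosh (s * b) ^ t.card := by
  classical
  induction t using Finset.induction_on with
  | empty => simp
  | insert i t hi ih =>
    have hS : Measurable fun ω => ∑ j ∈ t, Y j ω := by fun_prop
    have hI : IndepFun (fun ω => ∑ j ∈ t, Y j ω) (Y i) μ := by
      have := hind.indepFun_finsetSum_of_notMem hm hi
      rwa [show (∑ j ∈ t, Y j) = fun ω => ∑ j ∈ t, Y j ω from by ext; simp] at this
    have hp := (indepFun_iff_map_prod_eq_prod_map_map hS.aemeasurable (hm i).aemeasurable).1 hI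
    have := Measure.isProbabilityMeasure_map (μ := μ) hS.aemeasurable
    have := Measure.isProbabilityMeasure_map (μ := μ) (hm i).aemeasurable
    have hbd (u : Finset ι) (ω : Ω) : ‖∑ j ∈ u, Y j ω‖ ≤ u.card * b := by
      refine (norm_sum_le _ _).trans ((Finset.sum_le_card_nsmul _ _ b fun j _ => hY j ω).trans ?_)
      simp
    have hcint (u : Finset ι) : Integrable (fun ω => Real.cosh (s * ‖∑ j ∈ u, Y j ω‖)) μ := by
      refine Integrable.of_bound (C := Real.cosh (s * (u.card * b))) ?_ (.of_forall fun ω => ?_)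
      · have : Measurable fun ω => ∑ j ∈ u, Y j ω := by fun_prop
        exact (Real.continuous_cosh.measurable.comp (this.norm.const_mul s)).aestronglyMeasurable
      · rw [Real.norm_of_nonneg (Real.cosh_pos _).le, Real.cosh_le_cosh,
          abs_of_nonneg (by positivity), abs_of_nonneg (by positivity)]
        exact mul_le_mul_of_nonneg_left (hbd u ω) hs
    have hF : Measurable fun z : E × E => Real.cosh (s * ‖z.1 + z.2‖) := by
      have : Continuous fun z : E × E => Real.cosh (s * ‖z.1 + z.2‖) :=
        Real.continuous_cosh.comp (by fun_prop)
      exact this.measurable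
    have hν : ∀ᵐ y ∂(μ.map (Y i)), ‖y‖ ≤ b := by
      rw [ae_map_iff (hm i).aemeasurable (measurableSet_le measurable_norm measurable_const)]
      exact .of_forall (hY i)
    have h0' : ∫ y, y ∂(μ.map (Y i)) = 0 := by
      rw [integral_map (hm i).aemeasurable (by fun_prop)]; exact h0 i
    have hpm : Measurable fun ω => (∑ j ∈ t, Y j ω, Y i ω) := hS.prodMk (hm i)
    have hint : Integrable (fun z : E × E => Real.cosh (s * ‖z.1 + z.2‖))
        ((μ.map fun ω => ∑ j ∈ t, Y j ω).prod (μ.map (Y i))) := by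
      rw [← hp, integrable_map_measure hF.aestronglyMeasurable hpm.aemeasurable]
      refine (hcint (insert i t)).congr (.of_forall fun ω => ?_)
      simp [Finset.sum_insert hi, add_comm]
    calc ∫ ω, Real.cosh (s * ‖∑ j ∈ insert i t, Y j ω‖) ∂μ
        = ∫ z, Real.cosh (s * ‖z.1 + z.2‖) ∂(μ.map fun ω => (∑ j ∈ t, Y j ω, Y i ω)) := by
          rw [integral_map hpm.aemeasurable hF.aestronglyMeasurable]
          simp [Finset.sum_insert hi, add_comm]
      _ = ∫ x, ∫ y, Real.cosh (s * ‖x + y‖) ∂(μ.map (Y i)) ∂(μ.map fun ω => ∑ j ∈ t, Y j ω) := by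
          rw [hp, integral_prod _ hint]
      _ ≤ ∫ x, Real.cosh (s * ‖x‖) * Real.cosh (s * b) ∂(μ.map fun ω => ∑ j ∈ t, Y j ω) := by
          refine integral_mono hint.integral_prod_left ?_ fun x =>
            integral_cosh_norm_add_le _ hs hb hν h0' x
          have hc : Measurable fun x : E => Real.cosh (s * ‖x‖) * Real.cosh (s * b) := by
            have : Continuous fun x : E => Real.cosh (s * ‖x‖) :=
              Real.continuous_cosh.comp (by fun_prop)
            exact this.measurable.mul_const _
          rw [integrable_map_measure hc.aestronglyMeasurable hS.aemeasurable]
          exact (hcint t).mul_const _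
      _ = (∫ ω, Real.cosh (s * ‖∑ j ∈ t, Y j ω‖) ∂μ) * Real.cosh (s * b) := by
          have hc : Measurable fun x : E => Real.cosh (s * ‖x‖) :=
            (Real.continuous_cosh.comp (by fun_prop : Continuous fun x : E => s * ‖x‖)).measurable
          rw [integral_mul_const, integral_map hS.aemeasurable hc.aestronglyMeasurable]
      _ ≤ Real.cosh (s * b) ^ (insert i t).card := by
          rw [Finset.card_insert_of_notMem hi, pow_succ]
          exact mul_le_mul_of_nonneg_right ih (Real.cosh_pos _).le

/-- Hoeffding's inequality for sums of bounded centered independent vectors in a Hilbert space. -/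
theorem measureReal_norm_sum_ge_le {Ω ι : Type*} [Fintype ι] [MeasurableSpace Ω] {μ : Measure Ω}
    [IsProbabilityMeasure μ] {Y : ι → Ω → E} (hm : ∀ i, Measurable (Y i)) (hind : iIndepFun Y μ)
    {b r : ℝ} (hb : 0 < b) (hr : 0 ≤ r) (hY : ∀ i ω, ‖Y i ω‖ ≤ b) (h0 : ∀ i, ∫ ω, Y i ω ∂μ = 0)
    (hn : 0 < Fintype.card ι) :
    μ.real {ω | r ≤ ‖∑ i, Y i ω‖} ≤ 2 * Real.exp (-(r ^ 2 / (2 * Fintype.card ι * b ^ 2))) := by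
  have hn' : (0 : ℝ) < Fintype.card ι := by exact_mod_cast hn
  -- The minimizer of the Chernoff exponent `n s² b² / 2 - s r`.
  set s := r / (Fintype.card ι * b ^ 2) with hs
  have hs0 : 0 ≤ s := by positivity
  have hS : Measurable fun ω => ∑ j, Y j ω := by fun_prop
  have hbd (ω : Ω) : ‖∑ j, Y j ω‖ ≤ Fintype.card ι * b := by
    refine (norm_sum_le _ _).trans ((Finset.sum_le_card_nsmul _ _ b fun j _ => hY j ω).trans ?_)
    simp
  have hcint : Integrable (fun ω => Real.cosh (s * ‖∑ j, Y j ω‖)) μ := by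
    refine Integrable.of_bound (C := Real.cosh (s * (Fintype.card ι * b))) ?_
      (.of_forall fun ω => ?_)
    · exact (Real.continuous_cosh.measurable.comp (hS.norm.const_mul s)).aestronglyMeasurable
    · rw [Real.norm_of_nonneg (Real.cosh_pos _).le, Real.cosh_le_cosh,
        abs_of_nonneg (by positivity), abs_of_nonneg (by positivity)]
      exact mul_le_mul_of_nonneg_left (hbd ω) hs0
  have h1 := mul_meas_ge_le_integral_of_nonneg (.of_forall fun ω => (Real.cosh_pos _).le) hcint
    (Real.cosh (s * r))
  have h2 := (integral_cosh_norm_sum_le hm hind hs0 hb.le hY h0 Finset.univ)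
  have h3 : μ.real {ω | r ≤ ‖∑ i, Y i ω‖} ≤
      μ.real {ω | Real.cosh (s * r) ≤ Real.cosh (s * ‖∑ i, Y i ω‖)} := by
    refine measureReal_mono fun ω hω => ?_
    simp only [Set.mem_ofPred_eq] at hω ⊢
    rw [Real.cosh_le_cosh, abs_of_nonneg (by positivity), abs_of_nonneg (by positivity)]
    exact mul_le_mul_of_nonneg_left hω hs0
  have h4 : Real.cosh (s * b) ^ Fintype.card ι ≤ Real.exp (Fintype.card ι * (s * b) ^ 2 / 2) := by
    refine (pow_le_pow_left₀ (Real.cosh_pos _).le (Real.cosh_le_exp_half_sq _) _).trans ?_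
    rw [← Real.exp_nat_mul]
    exact le_of_eq (by ring_nf)
  have h5 : Real.exp (s * r) / 2 ≤ Real.cosh (s * r) := by
    rw [Real.cosh_eq]; linarith [Real.exp_pos (-(s * r))]
  have h6 : Real.exp (s * r) / 2 * μ.real {ω | r ≤ ‖∑ i, Y i ω‖} ≤
      Real.exp (Fintype.card ι * (s * b) ^ 2 / 2) :=
    (mul_le_mul h5 h3 measureReal_nonneg (Real.cosh_pos _).le).trans (h1.trans (h2.trans h4))
  have e : -(r ^ 2 / (2 * Fintype.card ι * b ^ 2)) =
      Fintype.card ι * (s * b) ^ 2 / 2 - s * r := by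
    rw [hs]; field_simp; ring
  rw [e, Real.exp_sub, ← mul_div_assoc, le_div_iff₀ (Real.exp_pos _)]
  linarith

end Hoeffding

/-! ### Exponential moments of one-dimensional marginals -/

section Subgaussian

variable {Ω : Type*} [MeasurableSpace Ω] {μ : Measure Ω} [IsProbabilityMeasure μ]

/-- Layer cake: levels in `(0, 1]` contribute at most 1, and levels above 1 at most `∫ 2 t⁻² = 2`.
-/
theorem lintegral_le_three_of_tail {f : Ω → ℝ} (hf : Measurable f) (h0 : ∀ ω, 0 ≤ f ω)
    (h : ∀ t, 1 < t → μ.real {ω | t < f ω} ≤ 2 * t ^ (-2 : ℝ)) :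
    ∫⁻ ω, ENNReal.ofReal (f ω) ∂μ ≤ 3 := by
  rw [lintegral_eq_lintegral_meas_lt μ (.of_forall h0) hf.aemeasurable,
    ← Set.Ioc_union_Ioi_eq_Ioi zero_le_one, lintegral_union measurableSet_Ioi
      (Set.Ioc_disjoint_Ioi le_rfl)]
  have h1 : ∫⁻ t in Set.Ioc (0 : ℝ) 1, μ {ω | t < f ω} ≤ 1 := by
    calc _ ≤ ∫⁻ _ in Set.Ioc (0 : ℝ) 1, 1 := lintegral_mono fun t => prob_le_one
      _ = 1 := by simp
  have hint : IntegrableOn (fun t : ℝ => 2 * t ^ (-2 : ℝ)) (Set.Ioi 1) :=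
    (integrableOn_Ioi_rpow_of_lt (by norm_num) one_pos).const_mul 2
  have h2 : ∫⁻ t in Set.Ioi (1 : ℝ), μ {ω | t < f ω} ≤ 2 := by
    calc _ ≤ ∫⁻ t in Set.Ioi (1 : ℝ), ENNReal.ofReal (2 * t ^ (-2 : ℝ)) := by
          refine setLIntegral_mono' measurableSet_Ioi fun t ht => ?_
          rw [← ofReal_measureReal]
          exact ENNReal.ofReal_le_ofReal (h t ht)
      _ = ENNReal.ofReal (∫ t in Set.Ioi (1 : ℝ), 2 * t ^ (-2 : ℝ)) := by
          refine (ofReal_integral_eq_lintegral_ofReal hint ?_).symm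
          filter_upwards [ae_restrict_mem measurableSet_Ioi] with t ht
          have : (0 : ℝ) < t := one_pos.trans ht
          positivity
      _ = 2 := by
          rw [integral_const_mul, integral_Ioi_rpow_of_lt (by norm_num) one_pos]
          norm_num
  calc _ ≤ (1 : ENNReal) + 2 := add_le_add h1 h2
    _ = 3 := by norm_num

/-- The scale `4v` turns the subgaussian tail of `exp (Z² / (4v))` into exactly `2 t⁻²`, and `Z ≤ Z²
/ (4v) + v` by completing the square. No centering of `Z` is needed. -/
theorem lintegral_exp_le_of_subgaussian {Z : Ω → ℝ} (hZ : Measurable Z) {v : ℝ} (hv : 0 < v)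
    (h : ∀ t, 0 < t → μ.real {ω | t < |Z ω|} ≤ 2 * Real.exp (-(1 / 2) * (t ^ 2 / v))) :
    ∫⁻ ω, ENNReal.ofReal (Real.exp (Z ω)) ∂μ ≤ 3 * ENNReal.ofReal (Real.exp v) := by
  have h3 : ∫⁻ ω, ENNReal.ofReal (Real.exp (Z ω ^ 2 / (4 * v))) ∂μ ≤ 3 := by
    refine lintegral_le_three_of_tail (by fun_prop) (fun ω => (Real.exp_pos _).le) fun t ht => ?_
    have ht0 : 0 < t := one_pos.trans ht
    have hl := Real.log_pos ht
    have hs : 0 < √(4 * v * Real.log t) := Real.sqrt_pos.2 (by positivity)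
    convert h _ hs using 3
    · ext ω
      rw [← Real.log_lt_iff_lt_exp ht0, lt_div_iff₀ (by positivity),
        ← Real.sqrt_sq_eq_abs, Real.sqrt_lt_sqrt_iff (by positivity), mul_comm]
    · rw [Real.rpow_def_of_pos ht0, Real.sq_sqrt (by positivity)]
      congr 1
      field_simp
      ring
  calc ∫⁻ ω, ENNReal.ofReal (Real.exp (Z ω)) ∂μ
      ≤ ∫⁻ ω, ENNReal.ofReal (Real.exp (Z ω ^ 2 / (4 * v))) * ENNReal.ofReal (Real.exp v) ∂μ := by
        refine lintegral_mono fun ω => ?_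
        rw [← ENNReal.ofReal_mul (Real.exp_pos _).le, ← Real.exp_add]
        refine ENNReal.ofReal_le_ofReal (Real.exp_le_exp.2 ?_)
        have : Z ω ^ 2 / (4 * v) + v - Z ω = (Z ω - 2 * v) ^ 2 / (4 * v) := by field_simp; ring
        have : 0 ≤ (Z ω - 2 * v) ^ 2 / (4 * v) := by positivity
        linarith
    _ ≤ 3 * ENNReal.ofReal (Real.exp v) := by
        rw [lintegral_mul_const' _ _ ENNReal.ofReal_ne_top]
        gcongr

theorem IsSubgaussianVec.lintegral_exp_inner_le {d : ℕ} {S : Matrix (Fin d) (Fin d) ℝ}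
    (hS : S.PosDef) {X : Ω → EuclideanSpace ℝ (Fin d)} (hX : IsSubgaussianVec S X μ)
    (u : EuclideanSpace ℝ (Fin d)) :
    ∫⁻ ω, ENNReal.ofReal (Real.exp (inner ℝ (X ω) u)) ∂μ ≤
      3 * ENNReal.ofReal (Real.exp (u.ofLp ⬝ᵥ (S *ᵥ u.ofLp))) := by
  rcases eq_or_ne u 0 with rfl | hu
  · simp
  · have hv : 0 < u.ofLp ⬝ᵥ (S *ᵥ u.ofLp) := by
      simpa using hS.dotProduct_mulVec_pos (x := u.ofLp) (by simpa using hu)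
    have hXm := hX.1
    refine lintegral_exp_le_of_subgaussian (by fun_prop) hv fun t ht => ?_
    have hn : 0 < ‖u‖ := norm_pos_iff.2 hu
    -- The tail hypothesis covers only the unit ball; it extends to every `u` because `t² / (uᵀSu)`
    -- is invariant under scaling `t` and `u` together.
    have h := hX.2 (‖u‖⁻¹ * t) (by positivity) (‖u‖⁻¹ • u) (by simp [norm_smul, hn.ne'])
    convert h using 3
    · ext ω
      rw [inner_smul_right, abs_mul,
        abs_of_pos (inv_pos.2 hn), mul_lt_mul_iff_right₀ (inv_pos.2 hn)]
    · rw [WithLp.ofLp_smul, Matrix.mulVec_smul, dotProduct_smul, smul_dotProduct]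
      simp only [smul_eq_mul]
      field_simp

end Subgaussian

/-! ### Gaussian exponential integrals -/

section Gaussian

theorem lintegral_pi_prod {ι : Type*} [Fintype ι] (γ : Measure ℝ) [IsProbabilityMeasure γ]
    {f : ι → ℝ → ℝ} (hf : ∀ i, Integrable (f i) γ) (h0 : ∀ i x, 0 ≤ f i x) :
    ∫⁻ x, ENNReal.ofReal (∏ i, f i (x i)) ∂(Measure.pi fun _ : ι => γ) =
      ENNReal.ofReal (∏ i, ∫ x, f i x ∂γ) := by
  rw [← ofReal_integral_eq_lintegral_ofReal (Integrable.fintype_prod hf)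
    (.of_forall fun x => Finset.prod_nonneg fun i _ => h0 i _), integral_fintype_prod_eq_prod]

theorem lintegral_pi_gaussianReal_exp_linear {ι : Type*} [Fintype ι] (y : ι → ℝ) :
    ∫⁻ g, ENNReal.ofReal (Real.exp (∑ i, y i * g i))
        ∂(Measure.pi fun _ : ι => gaussianReal 0 1) =
      ENNReal.ofReal (Real.exp ((∑ i, y i ^ 2) / 2)) := by
  have h (i : ι) : ∫ x, Real.exp (y i * x) ∂(gaussianReal 0 1) = Real.exp (y i ^ 2 / 2) := by
    have := congrFun (mgf_id_gaussianReal (μ := 0) (v := 1)) (y i)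
    simpa [mgf] using this
  simp_rw [Real.exp_sum]
  rw [lintegral_pi_prod _ (f := fun i x => Real.exp (y i * x))
    (fun i => integrable_exp_mul_gaussianReal (y i)) (fun _ _ => (Real.exp_pos _).le)]
  simp_rw [h, ← Real.exp_sum, Finset.sum_div]

theorem gaussianPDFReal_mul_exp_sq (a x : ℝ) :
    gaussianPDFReal 0 1 x • Real.exp (a * x ^ 2) =
      (√(2 * Real.pi))⁻¹ * Real.exp (-(1 / 2 - a) * x ^ 2) := by
  rw [gaussianPDFReal, smul_eq_mul, mul_assoc, ← Real.exp_add]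
  simp only [NNReal.coe_one, sub_zero, mul_one]
  ring_nf

theorem integrable_exp_sq_gaussianReal {a : ℝ} (ha : a ≤ 1 / 4) :
    Integrable (fun x => Real.exp (a * x ^ 2)) (gaussianReal 0 1) := by
  rw [gaussianReal_of_var_ne_zero _ one_ne_zero, gaussianPDF_def,
    integrable_withDensity_iff_integrable_smul₀' (by fun_prop) (by simp)]
  simp only [ENNReal.toReal_ofReal (gaussianPDFReal_nonneg _ _ _), gaussianPDFReal_mul_exp_sq]
  exact (integrable_exp_neg_mul_sq (by linarith)).const_mul _

/-- The integral is `(1 - 2a)^{-1/2}`. After squaring, the claim follows from `1 ≤ (1 + 4a)(1 -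
2a)`, which is where `a ≤ 1/4` enters. -/
theorem integral_exp_sq_gaussianReal_le {a : ℝ} (h0 : 0 ≤ a) (ha : a ≤ 1 / 4) :
    ∫ x, Real.exp (a * x ^ 2) ∂(gaussianReal 0 1) ≤ Real.exp (2 * a) := by
  rw [integral_gaussianReal_eq_integral_smul one_ne_zero]
  simp only [gaussianPDFReal_mul_exp_sq]
  rw [integral_const_mul, integral_gaussian, ← Real.sqrt_inv, ← Real.sqrt_mul (by positivity),
    Real.sqrt_le_left (Real.exp_pos _).le, ← Real.exp_nat_mul]
  have h1 : 0 < 1 / 2 - a := by linarith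
  have h2 := Real.add_one_le_exp (((2 : ℕ) : ℝ) * (2 * a))
  push_cast at h2 ⊢
  have hpi := Real.pi_pos
  rw [show (2 * Real.pi)⁻¹ * (Real.pi / (1 / 2 - a)) = 1 / (1 - 2 * a) by
    have : 1 - 2 * a ≠ 0 := by linarith
    field_simp, div_le_iff₀ (by linarith)]
  nlinarith

theorem lintegral_pi_gaussianReal_exp_sq_le {ι : Type*} [Fintype ι] {a : ι → ℝ}
    (h0 : ∀ i, 0 ≤ a i) (ha : ∀ i, a i ≤ 1 / 4) :
    ∫⁻ g, ENNReal.ofReal (Real.exp (∑ i, a i * g i ^ 2))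
        ∂(Measure.pi fun _ : ι => gaussianReal 0 1) ≤
      ENNReal.ofReal (Real.exp (2 * ∑ i, a i)) := by
  simp_rw [Real.exp_sum]
  rw [lintegral_pi_prod _ (f := fun i x => Real.exp (a i * x ^ 2))
    (fun i => integrable_exp_sq_gaussianReal (ha i)) (fun _ _ => (Real.exp_pos _).le),
    Finset.mul_sum, Real.exp_sum]
  exact ENNReal.ofReal_le_ofReal (Finset.prod_le_prod
    (fun i _ => integral_nonneg fun _ => (Real.exp_pos _).le)
    fun i _ => integral_exp_sq_gaussianReal_le (h0 i) (ha i))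

end Gaussian

/-! ### Exponential moment of the squared norm -/

section Norm

variable {d : ℕ} {S : Matrix (Fin d) (Fin d) ℝ}

theorem sigmaOne_sq (hS : S.PosDef) : sigmaOne hS ^ 2 = ⨆ i, hS.1.eigenvalues i :=
  Real.sq_sqrt (Real.iSup_nonneg fun i => (hS.eigenvalues_pos i).le)

theorem eigenvalues_le_sigmaOne_sq (hS : S.PosDef) (i : Fin d) :
    hS.1.eigenvalues i ≤ sigmaOne hS ^ 2 := by
  rw [sigmaOne_sq]
  exact le_ciSup (Set.finite_range _).bddAbove i

theorem sigmaOne_pos (hd : 1 ≤ d) (hS : S.PosDef) : 0 < sigmaOne hS := by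
  have h := (hS.eigenvalues_pos ⟨0, hd⟩).trans_le (eigenvalues_le_sigmaOne_sq hS ⟨0, hd⟩)
  exact (Real.sqrt_nonneg _).lt_of_ne fun h0 => by
    rw [show sigmaOne hS = 0 from h0.symm] at h; simp at h

theorem trace_eq_sum_eigenvalues_real (hS : S.PosDef) :
    S.trace = ∑ i, hS.1.eigenvalues i := by
  simpa using hS.1.trace_eq_sum_eigenvalues

theorem one_le_effDim (hd : 1 ≤ d) (hS : S.PosDef) : 1 ≤ effDim hS := by
  have : Nonempty (Fin d) := ⟨⟨0, hd⟩⟩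
  have h := sigmaOne_pos hd hS
  rw [effDim, one_le_div (by positivity), sigmaOne_sq, trace_eq_sum_eigenvalues_real hS]
  exact ciSup_le fun i => Finset.single_le_sum (f := hS.1.eigenvalues)
    (fun j _ => (hS.eigenvalues_pos j).le) (Finset.mem_univ i)

/-- The squared norm is linearized by an auxiliary Gaussian vector in the eigenbasis of `S`. Working
with `∫⁻` makes the exchange of integrals free of integrability conditions. -/
theorem IsSubgaussianVec.lintegral_exp_norm_sq_le {Ω : Type*} [MeasurableSpace Ω] {μ : Measure Ω}
    [IsProbabilityMeasure μ] (hd : 1 ≤ d) (hS : S.PosDef) {X : Ω → EuclideanSpace ℝ (Fin d)}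
    (hX : IsSubgaussianVec S X μ) :
    ∫⁻ ω, ENNReal.ofReal (Real.exp (‖X ω‖ ^ 2 / (8 * sigmaOne hS ^ 2))) ∂μ ≤
      3 * ENNReal.ofReal (Real.exp (effDim hS / 2)) := by
  have hσ := sigmaOne_pos hd hS
  set σ := sigmaOne hS with hσd
  set v := hS.1.eigenvectorBasis with hv
  set lam := hS.1.eigenvalues with hlam
  -- The factor `1 / (2σ)` makes the quadratic form's coefficients `lam i / (4σ²)` at most `1/4`, as
  -- the Gaussian bound requires.
  let u : (Fin d → ℝ) → EuclideanSpace ℝ (Fin d) := fun g => (1 / (2 * σ)) • ∑ i, g i • v i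
  have hu : Measurable u := by
    have : Continuous u := by fun_prop
    exact this.measurable
  have hinner (x : EuclideanSpace ℝ (Fin d)) (g : Fin d → ℝ) :
      inner ℝ x (u g) = ∑ i, (1 / (2 * σ) * inner ℝ (v i) x) * g i := by
    simp only [u, inner_smul_right, inner_sum, Finset.mul_sum, real_inner_comm x]
    exact Finset.sum_congr rfl fun i _ => by ring
  have hnorm (x : EuclideanSpace ℝ (Fin d)) :
      (∑ i, (1 / (2 * σ) * inner ℝ (v i) x) ^ 2) / 2 = ‖x‖ ^ 2 / (8 * σ ^ 2) := by
    rw [← v.sum_sq_inner_right x, Finset.sum_div, Finset.sum_div]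
    refine Finset.sum_congr rfl fun i _ => ?_
    field_simp
    ring
  have hquad (g : Fin d → ℝ) : (u g).ofLp ⬝ᵥ (S *ᵥ (u g).ofLp) =
      ∑ i, lam i / (4 * σ ^ 2) * g i ^ 2 := by
    have h1 : S *ᵥ (u g).ofLp = (WithLp.ofLp ((1 / (2 * σ)) • ∑ i, (g i * lam i) • v i)) := by
      simp only [u, WithLp.ofLp_smul, WithLp.ofLp_sum, Matrix.mulVec_smul, Matrix.mulVec_sum]
      congr 1
      refine Finset.sum_congr rfl fun i _ => ?_
      rw [hv, hS.1.mulVec_eigenvectorBasis, smul_smul]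
    have h2 (a b : EuclideanSpace ℝ (Fin d)) : a.ofLp ⬝ᵥ b.ofLp = inner ℝ a b := by
      simp [PiLp.inner_apply, dotProduct, mul_comm]
    rw [h1, h2]
    simp only [u, inner_smul_left, inner_smul_right, sum_inner, inner_sum,
      v.inner_eq_ite]
    simp [Finset.mul_sum]
    refine Finset.sum_congr rfl fun i _ => ?_
    field_simp
    ring
  have hXm := hX.1
  have hjm : Measurable fun z : Ω × (Fin d → ℝ) =>
      ENNReal.ofReal (Real.exp (inner ℝ (X z.1) (u z.2))) := by fun_prop
  calc ∫⁻ ω, ENNReal.ofReal (Real.exp (‖X ω‖ ^ 2 / (8 * σ ^ 2))) ∂μ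
      = ∫⁻ ω, ∫⁻ g, ENNReal.ofReal (Real.exp (inner ℝ (X ω) (u g)))
          ∂(Measure.pi fun _ : Fin d => gaussianReal 0 1) ∂μ := by
        refine lintegral_congr fun ω => ?_
        simp_rw [hinner, lintegral_pi_gaussianReal_exp_linear, hnorm]
    _ = ∫⁻ g, ∫⁻ ω, ENNReal.ofReal (Real.exp (inner ℝ (X ω) (u g))) ∂μ
          ∂(Measure.pi fun _ : Fin d => gaussianReal 0 1) :=
        lintegral_lintegral_swap hjm.aemeasurable
    _ ≤ ∫⁻ g, 3 * ENNReal.ofReal (Real.exp (∑ i, lam i / (4 * σ ^ 2) * g i ^ 2))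
          ∂(Measure.pi fun _ : Fin d => gaussianReal 0 1) := by
        refine lintegral_mono fun g => ?_
        rw [← hquad]
        exact hX.lintegral_exp_inner_le hS (u g)
    _ ≤ 3 * ENNReal.ofReal (Real.exp (2 * ∑ i, lam i / (4 * σ ^ 2))) := by
        rw [lintegral_const_mul' _ _ (by norm_num)]
        gcongr
        refine lintegral_pi_gaussianReal_exp_sq_le
          (fun i => div_nonneg (hS.eigenvalues_pos i).le (by positivity)) fun i => ?_
        have := eigenvalues_le_sigmaOne_sq hS i
        rw [div_le_iff₀ (by positivity)]
        linarith
    _ = 3 * ENNReal.ofReal (Real.exp (effDim hS / 2)) := by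
        rw [effDim, trace_eq_sum_eigenvalues_real hS, ← Finset.sum_div]
        congr 3
        rw [← hσd, ← hlam]
        field_simp
        ring

end Norm

/-! ### Tails and truncated moments from an exponential moment -/

section Tail

variable {Ω : Type*} [MeasurableSpace Ω] {μ : Measure Ω}

theorem integrable_exp_of_lintegral_le {f : Ω → ℝ} (hf : Measurable f) {A : ℝ}
    (h : ∫⁻ ω, ENNReal.ofReal (Real.exp (f ω)) ∂μ ≤ ENNReal.ofReal A) :
    Integrable (fun ω => Real.exp (f ω)) μ :=
  ⟨by fun_prop, by
    rw [hasFiniteIntegral_iff_ofReal (.of_forall fun _ => (Real.exp_pos _).le)]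
    exact h.trans_lt ENNReal.ofReal_lt_top⟩

theorem integral_exp_le_of_lintegral_le {f : Ω → ℝ} (hf : Measurable f) {A : ℝ} (hA : 0 ≤ A)
    (h : ∫⁻ ω, ENNReal.ofReal (Real.exp (f ω)) ∂μ ≤ ENNReal.ofReal A) :
    ∫ ω, Real.exp (f ω) ∂μ ≤ A := by
  rw [integral_eq_lintegral_of_nonneg_ae (.of_forall fun _ => (Real.exp_pos _).le) (by fun_prop)]
  exact ENNReal.toReal_le_of_le_ofReal hA h

theorem measureReal_lt_le_of_integral_exp_sq [IsFiniteMeasure μ] {N : Ω → ℝ} {c K A R : ℝ}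
    (hc : 0 < c) (hR : 0 ≤ R) (hRK : R ^ 2 = c * K)
    (hi : Integrable (fun ω => Real.exp (N ω ^ 2 / c)) μ)
    (hA : ∫ ω, Real.exp (N ω ^ 2 / c) ∂μ ≤ A) :
    μ.real {ω | R < N ω} ≤ A * Real.exp (-K) := by
  have h := mul_meas_ge_le_integral_of_nonneg (.of_forall fun _ => (Real.exp_pos _).le) hi
    (Real.exp K)
  have h1 : μ.real {ω | R < N ω} ≤ μ.real {ω | Real.exp K ≤ Real.exp (N ω ^ 2 / c)} := by
    refine measureReal_mono fun ω hω => ?_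
    simp only [Set.mem_ofPred_eq] at hω ⊢
    rw [Real.exp_le_exp, le_div_iff₀ hc, mul_comm, ← hRK]
    exact pow_le_pow_left₀ hR hω.le 2
  have h2 := (mul_le_mul_of_nonneg_left h1 (Real.exp_pos K).le).trans (h.trans hA)
  rw [Real.exp_neg, ← div_eq_mul_inv, le_div_iff₀ (Real.exp_pos _)]
  linarith

/-- Write `x² = c (K + u)` with `u ≥ 0`. Since `K ≥ 1`, `K + u ≤ K (1 + u)²`, so `x ≤ R (1 + u)`,
and `(1 + u)^p ≤ p! e^{1+u}`. The factor `exp (1 - K)` is what makes the truncation bias small. -/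
theorem pow_le_of_lt {x c K R : ℝ} (p : ℕ) (hc : 0 < c) (hK : 1 ≤ K) (hR : 0 ≤ R)
    (hRK : R ^ 2 = c * K) (hx : R < x) :
    x ^ p ≤ R ^ p * p.factorial * Real.exp (1 - K) * Real.exp (x ^ 2 / c) := by
  have hx0 : 0 ≤ x := hR.trans hx.le
  set u := x ^ 2 / c - K with hu
  have hu0 : 0 ≤ u := by
    have : K ≤ x ^ 2 / c := by
      rw [le_div_iff₀ hc, mul_comm, ← hRK]
      exact pow_le_pow_left₀ hR hx.le 2
    linarith
  have hx2 : x ^ 2 = c * (K + u) := by rw [hu]; field_simp; ring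
  have h1 : x ≤ R * (1 + u) := by
    refine pow_le_pow_iff_left₀ hx0 (by positivity) two_ne_zero |>.1 ?_
    rw [mul_pow, hRK, hx2, mul_assoc]
    refine mul_le_mul_of_nonneg_left ?_ hc.le
    nlinarith [mul_nonneg hu0 (sub_nonneg.2 hK), mul_nonneg hu0 hu0,
      mul_nonneg (mul_nonneg hu0 hu0) (zero_le_one.trans hK)]
  have h2 : (1 + u) ^ p ≤ p.factorial * Real.exp (1 + u) := by
    have := Real.pow_div_factorial_le_exp (x := 1 + u) (by linarith) p
    rwa [div_le_iff₀ (by positivity), mul_comm] at this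
  calc x ^ p ≤ (R * (1 + u)) ^ p := pow_le_pow_left₀ hx0 h1 p
    _ = R ^ p * (1 + u) ^ p := mul_pow _ _ _
    _ ≤ R ^ p * (p.factorial * Real.exp (1 + u)) := by gcongr
    _ = _ := by
      rw [mul_assoc _ (Real.exp _), ← Real.exp_add, mul_assoc]
      congr 3
      rw [hu]; ring

theorem integrable_pow_of_integrable_exp_sq [IsFiniteMeasure μ] {N : Ω → ℝ} (hN : Measurable N) (h0 : ∀ ω, 0 ≤ N ω)
    {c : ℝ} (hc : 0 < c) (p : ℕ) (hi : Integrable (fun ω => Real.exp (N ω ^ 2 / c)) μ) :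
    Integrable (fun ω => N ω ^ p) μ := by
  have hR : √c ^ 2 = c * 1 := by rw [Real.sq_sqrt hc.le, mul_one]
  refine ((integrable_const (√c ^ p)).add
    (hi.const_mul (√c ^ p * p.factorial * Real.exp (1 - 1)))).mono' (by fun_prop)
    (.of_forall fun ω => ?_)
  simp only [Pi.add_apply]
  rw [Real.norm_of_nonneg (pow_nonneg (h0 ω) p)]
  rcases le_or_gt (N ω) √c with h | h
  · have := pow_le_pow_left₀ (h0 ω) h p
    have : 0 ≤ √c ^ p * p.factorial * Real.exp (1 - 1) * Real.exp (N ω ^ 2 / c) := by positivity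
    linarith
  · have := pow_le_of_lt p hc le_rfl (Real.sqrt_nonneg c) hR h
    have : 0 ≤ √c ^ p := by positivity
    linarith

theorem integral_indicator_pow_le {N : Ω → ℝ} {c K A R : ℝ}
    (hc : 0 < c) (hK : 1 ≤ K) (hR : 0 ≤ R) (hRK : R ^ 2 = c * K) (p : ℕ) (h0 : ∀ ω, 0 ≤ N ω)
    (hi : Integrable (fun ω => Real.exp (N ω ^ 2 / c)) μ)
    (hA : ∫ ω, Real.exp (N ω ^ 2 / c) ∂μ ≤ A) :
    ∫ ω, {ω | R < N ω}.indicator (fun ω => N ω ^ p) ω ∂μ ≤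
      R ^ p * p.factorial * Real.exp (1 - K) * A := by
  calc _ ≤ ∫ ω, R ^ p * p.factorial * Real.exp (1 - K) * Real.exp (N ω ^ 2 / c) ∂μ := by
        refine integral_mono_of_nonneg (.of_forall fun ω => Set.indicator_nonneg
          (fun ω _ => pow_nonneg (h0 ω) p) ω) (hi.const_mul _) (.of_forall fun ω => ?_)
        dsimp only
        by_cases h : R < N ω
        · rw [Set.indicator_of_mem (show ω ∈ {ω | R < N ω} from h)]
          exact pow_le_of_lt p hc hK hR hRK h
        · rw [Set.indicator_of_notMem (show ω ∉ {ω | R < N ω} from h)]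
          positivity
    _ ≤ _ := by
        rw [integral_const_mul]
        exact mul_le_mul_of_nonneg_left hA (by positivity)

end Tail

/-! ### Truncation of unbounded summands -/

section Truncation

variable {E : Type*} [NormedAddCommGroup E] [InnerProductSpace ℝ E] [CompleteSpace E]
  [MeasurableSpace E] [BorelSpace E] [SecondCountableTopology E]

/-- Deviation of a sum of independent vectors, by truncation at level `ρ`. -/
theorem measureReal_norm_sum_sub_integral_ge_le {Ω : Type*} [MeasurableSpace Ω] {μ : Measure Ω}
    [IsProbabilityMeasure μ] {n : ℕ} (hn : 0 < n) {T : Fin n → Ω → E}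
    (hm : ∀ i, Measurable (T i)) (hind : iIndepFun T μ) (hi : ∀ i, Integrable (T i) μ)
    {ρ q β r : ℝ} (hρ : 0 < ρ) (hr : 0 ≤ r) (hq : ∀ i, μ.real {ω | ρ < ‖T i ω‖} ≤ q)
    (hβ : ∀ i, ∫ ω, {ω | ρ < ‖T i ω‖}.indicator (fun ω => ‖T i ω‖) ω ∂μ ≤ β) :
    μ.real {ω | r + n * β ≤ ‖∑ i, (T i ω - ∫ ω, T i ω ∂μ)‖} ≤
      n * q + 2 * Real.exp (-(r ^ 2 / (8 * n * ρ ^ 2))) := by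
  let f : E → E := {x | ‖x‖ ≤ ρ}.indicator id
  have hf : Measurable f :=
    measurable_id.indicator (measurableSet_le measurable_norm measurable_const)
  have hfb (x : E) : ‖f x‖ ≤ ρ := by
    by_cases hx : ‖x‖ ≤ ρ
    · simpa [f, Set.indicator_of_mem (show x ∈ {x | ‖x‖ ≤ ρ} from hx)] using hx
    · simpa [f, Set.indicator_of_notMem (show x ∉ {x | ‖x‖ ≤ ρ} from hx)] using hρ.le
  have hfi (i : Fin n) : Integrable (fun ω => f (T i ω)) μ :=
    Integrable.of_bound (hf.comp (hm i)).aestronglyMeasurable ρ (.of_forall fun ω => hfb _)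
  let m : Fin n → E := fun i => ∫ ω, f (T i ω) ∂μ
  have hmb (i : Fin n) : ‖m i‖ ≤ ρ := by
    simpa using norm_integral_le_of_norm_le_const (μ := μ) (.of_forall fun ω => hfb (T i ω))
  have hbias (i : Fin n) : ‖m i - ∫ ω, T i ω ∂μ‖ ≤ β := by
    rw [← integral_sub (hfi i) (hi i)]
    refine (norm_integral_le_integral_norm _).trans (le_trans (le_of_eq ?_) (hβ i))
    refine integral_congr_ae (.of_forall fun ω => ?_)
    by_cases hx : ‖T i ω‖ ≤ ρ
    · simp [f, Set.indicator, hx, hx.not_gt]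
    · simp [f, Set.indicator, hx, not_le.1 hx]
  have hZm (i : Fin n) : Measurable fun ω => f (T i ω) - m i := (hf.comp (hm i)).sub_const _
  -- Centering can double the norm, hence `b = 2ρ` and the 8 in the exponent.
  have hH := measureReal_norm_sum_ge_le hZm
    (hind.comp (fun i x => f x - m i) fun i => hf.sub_const _) (b := 2 * ρ) (r := r)
    (by positivity) hr (fun i ω => (norm_sub_le _ _).trans (by linarith [hfb (T i ω), hmb i]))
    (fun i => by rw [integral_sub (hfi i) (integrable_const _)]; simp [m]) (by simpa using hn)
  -- If no summand exceeds `ρ`, truncation changes only the means, at total cost `n * β`.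
  have hsub : {ω | r + n * β ≤ ‖∑ i, (T i ω - ∫ ω, T i ω ∂μ)‖} ⊆
      (⋃ i, {ω | ρ < ‖T i ω‖}) ∪ {ω | r ≤ ‖∑ i, (f (T i ω) - m i)‖} := by
    intro ω hω
    by_contra hc
    simp only [Set.mem_union, Set.mem_iUnion, Set.mem_ofPred_eq, not_or, not_exists, not_lt,
      not_le] at hc hω
    have e : ∑ i, (T i ω - ∫ ω, T i ω ∂μ) =
        ∑ i, (f (T i ω) - m i) + ∑ i, (m i - ∫ ω, T i ω ∂μ) := by
      rw [← Finset.sum_add_distrib]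
      refine Finset.sum_congr rfl fun i _ => ?_
      have : f (T i ω) = T i ω := Set.indicator_of_mem (show T i ω ∈ {x | ‖x‖ ≤ ρ} from hc.1 i) _
      rw [this]; abel
    have h1 : ‖∑ i, (m i - ∫ ω, T i ω ∂μ)‖ ≤ n * β := by
      refine (norm_sum_le _ _).trans
        ((Finset.sum_le_card_nsmul _ _ β fun i _ => hbias i).trans ?_)
      simp
    have h2 := norm_add_le (∑ i, (f (T i ω) - m i)) (∑ i, (m i - ∫ ω, T i ω ∂μ))
    rw [← e] at h2
    linarith [hc.2]
  calc _ ≤ _ := measureReal_mono hsub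
    _ ≤ μ.real (⋃ i, {ω | ρ < ‖T i ω‖}) + μ.real {ω | r ≤ ‖∑ i, (f (T i ω) - m i)‖} :=
        measureReal_union_le _ _
    _ ≤ _ := by
        refine add_le_add ?_ (hH.trans (le_of_eq ?_))
        · refine (measureReal_iUnion_fintype_le _).trans
            ((Finset.sum_le_card_nsmul _ _ q fun i _ => hq i).trans ?_)
          simp
        · rw [Fintype.card_fin]
          ring_nf

end Truncation

/-! ### Reduction from tensors to Euclidean vectors -/

namespace Tensor

variable {p d : ℕ}

theorem frobNorm_eq_norm_toLp (A : Tensor p d) : frobNorm A = ‖WithLp.toLp 2 A‖ := by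
  simp [EuclideanSpace.norm_eq, frobNorm]

theorem opNorm_le_frobNorm (A : Tensor p d) : opNorm A ≤ frobNorm A := by
  refine Real.sSup_le ?_ (Real.sqrt_nonneg _)
  rintro r ⟨x, hx, rfl⟩
  calc scalarProd A (outer x) ≤ frobNorm A * frobNorm (outer x) :=
        Real.sum_mul_le_sqrt_mul_sqrt _ _ _
    _ ≤ frobNorm A * 1 := mul_le_mul_of_nonneg_left hx (Real.sqrt_nonneg _)
    _ = frobNorm A := mul_one _

theorem frobNorm_power (x : EuclideanSpace ℝ (Fin d)) : frobNorm (power p x) = ‖x‖ ^ p := by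
  have h : ∑ J : Fin p → Fin d, power p x J ^ 2 = (‖x‖ ^ p) ^ 2 := by
    rw [← pow_mul, mul_comm, pow_mul, EuclideanSpace.real_norm_sq_eq]
    simp only [power, outer, ← Finset.prod_pow]
    have := Finset.prod_univ_sum (fun _ : Fin p => (Finset.univ : Finset (Fin d)))
      (fun _ j => x j ^ 2)
    simpa using this.symm
  rw [frobNorm, h, Real.sqrt_sq (by positivity)]

theorem measurable_power : Measurable (power p : EuclideanSpace ℝ (Fin d) → Tensor p d) := by
  unfold power outer
  fun_prop

theorem frobNorm_empiricalMean_sub_expectation {Ω : Type*} [MeasurableSpace Ω] {μ : Measure Ω}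
    {n : ℕ} {T : Fin n → Ω → Tensor p d} (hT : ∀ i, Integrable (fun ω => WithLp.toLp 2 (T i ω)) μ)
    (ω : Ω) :
    frobNorm (empiricalMean T ω - expectation μ (empiricalMean T)) =
      1 / n * ‖∑ i, (WithLp.toLp 2 (T i ω) - ∫ ω, WithLp.toLp 2 (T i ω) ∂μ)‖ := by
  have hc (i : Fin n) (J : Fin p → Fin d) :
      (∫ ω, WithLp.toLp 2 (T i ω) ∂μ).ofLp J = ∫ ω, T i ω J ∂μ :=
    ((EuclideanSpace.proj (𝕜 := ℝ) J).integral_comp_comm (hT i)).symm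
  have hTi (i : Fin n) (J : Fin p → Fin d) : Integrable (fun ω => T i ω J) μ :=
    (EuclideanSpace.proj (𝕜 := ℝ) J).integrable_comp (hT i)
  rw [frobNorm_eq_norm_toLp, ← Real.norm_of_nonneg (show (0 : ℝ) ≤ 1 / n by positivity),
    ← norm_smul]
  congr 1
  ext J
  simp only [Pi.sub_apply, empiricalMean, expectation, PiLp.smul_apply, WithLp.ofLp_sum,
    Finset.sum_apply, PiLp.sub_apply, hc, smul_eq_mul]
  rw [integral_const_mul, integral_finsetSum _ fun i _ => hTi i J, Finset.sum_sub_distrib, mul_sub]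

end Tensor

/-! ### Choice of constants and the deviation bound -/

theorem logScale_le {De D L l : ℝ} (hDe : 1 ≤ De) (hD : De + l ≤ D) (hl : 0 ≤ l)
    (hL : Real.log 2 ≤ L) : De / 2 + L + l + Real.log 8 ≤ 6 * (D * L) := by
  have h2 := Real.log_two_gt_d9
  have h8 : Real.log 8 = 3 * Real.log 2 := by
    rw [show (8 : ℝ) = 2 ^ 3 by norm_num, Real.log_pow]; norm_num
  have h3 : (De + l) * L ≤ D * L := mul_le_mul_of_nonneg_right hD (by linarith)
  nlinarith [mul_nonneg hl (show 0 ≤ L - 0.69 by linarith),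
    mul_nonneg (sub_nonneg.2 hDe) (show 0 ≤ L - 0.69 by linarith)]

/-- The constant splits as follows: `7 ^ p` from `8 * 6 ≤ 7²`, the 4 from the Hoeffding fluctuation,
and `2 * p!` from the truncation bias, which is absorbed because `1 ≤ √(D / n) * n`. -/
theorem deviation_level_le {n p : ℕ} (hn : 2 ≤ n) {σ De D l : ℝ} (hσ : 0 < σ) (hDe : 1 ≤ De)
    (hD : De + l ≤ D) (hl : 0 ≤ l) :
    1 / n * (√(8 * σ ^ 2 * (De / 2 + Real.log n + l + Real.log 8)) ^ p *
        √(8 * n * (l + Real.log 4)) +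
      n * (√(8 * σ ^ 2 * (De / 2 + Real.log n + l + Real.log 8)) ^ p * p.factorial * (2 / n))) ≤
      7 ^ p * (4 + 2 * p.factorial) * σ ^ p * √(D ^ (p + 1) * Real.log n ^ p / n) := by
  have hn0 : (0 : ℝ) < n := by exact_mod_cast (by omega : 0 < n)
  have hn1 : (1 : ℝ) ≤ n := by exact_mod_cast (by omega : 1 ≤ n)
  have hL : Real.log 2 ≤ Real.log n :=
    Real.log_le_log (by norm_num) (by exact_mod_cast hn)
  have hL0 : 0 < Real.log n := (Real.log_pos (by norm_num)).trans_le hL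
  have hD1 : 1 ≤ D := by linarith
  have hK := logScale_le hDe hD hl hL
  set L := Real.log n
  set K := De / 2 + L + l + Real.log 8
  have hρ : √(8 * σ ^ 2 * K) ^ p ≤ 7 ^ p * σ ^ p * √((D * L) ^ p) := by
    have h1 : √(8 * σ ^ 2 * K) ≤ 7 * σ * √(D * L) := by
      rw [Real.sqrt_le_left (by positivity), mul_pow, Real.sq_sqrt (by positivity)]
      have : σ ^ 2 * K ≤ σ ^ 2 * (6 * (D * L)) := by gcongr
      have : 0 ≤ σ ^ 2 * (D * L) := by positivity
      linarith
    have h2 : √((D * L) ^ p) = √(D * L) ^ p := by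
      rw [Real.sqrt_eq_iff_mul_self_eq (by positivity) (by positivity), ← mul_pow,
        Real.mul_self_sqrt (by positivity)]
    rw [h2, ← mul_pow, ← mul_pow]
    exact pow_le_pow_left₀ (Real.sqrt_nonneg _) h1 p
  have h4 : √(8 * n * (l + Real.log 4)) ≤ 4 * √(D / n) * n := by
    rw [Real.sqrt_le_left (by positivity), mul_pow, mul_pow, Real.sq_sqrt (by positivity)]
    have h4' : Real.log 4 = 2 * Real.log 2 := by
      rw [show (4 : ℝ) = 2 ^ 2 by norm_num, Real.log_pow]; norm_num
    have := Real.log_two_lt_d9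
    have h5 : l + Real.log 4 ≤ 2 * D := by linarith
    have e : 4 ^ 2 * (D / n) * (n : ℝ) ^ 2 = 8 * n * (2 * D) := by field_simp; norm_num
    rw [e]
    gcongr
  have h5 : 1 ≤ √(D / n) * n := by
    rw [← Real.sqrt_sq hn0.le, ← Real.sqrt_mul (by positivity), Real.one_le_sqrt]
    rw [Real.sqrt_sq hn0.le, show D / n * (n : ℝ) ^ 2 = D * n by field_simp]
    nlinarith
  have e : √(D ^ (p + 1) * L ^ p / n) = √((D * L) ^ p) * √(D / n) := by
    rw [← Real.sqrt_mul (by positivity)]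
    congr 1
    rw [mul_pow, pow_succ]
    ring
  rw [e]
  have hf : (0 : ℝ) < p.factorial := by positivity
  calc _ = √(8 * σ ^ 2 * K) ^ p * (1 / n * (√(8 * n * (l + Real.log 4)) + 2 * p.factorial)) := by
        field_simp
    _ ≤ (7 ^ p * σ ^ p * √((D * L) ^ p)) *
          (1 / n * (4 * √(D / n) * n + 2 * p.factorial * (√(D / n) * n))) := by
        exact mul_le_mul hρ (mul_le_mul_of_nonneg_left (add_le_add h4
          (le_mul_of_one_le_right (by positivity) h5)) (by positivity)) (by positivity)
          (by positivity)
    _ = _ := by field_simp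

theorem IsSymmRankOneSubgaussian.exists_exp_bound {p d : ℕ} (hd : 1 ≤ d)
    {S : Matrix (Fin d) (Fin d) ℝ} (hS : S.PosDef) {Ω : Type*} [MeasurableSpace Ω] {μ : Measure Ω}
    [IsProbabilityMeasure μ] {T : Ω → Tensor p d} (hT : IsSymmRankOneSubgaussian S T μ) :
    Measurable T ∧ ∃ N : Ω → ℝ, Measurable N ∧ (∀ ω, 0 ≤ N ω) ∧
      (∀ ω, ‖WithLp.toLp 2 (T ω)‖ = N ω ^ p) ∧
      Integrable (fun ω => Real.exp (N ω ^ 2 / (8 * sigmaOne hS ^ 2))) μ ∧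
      ∫ ω, Real.exp (N ω ^ 2 / (8 * sigmaOne hS ^ 2)) ∂μ ≤ 3 * Real.exp (effDim hS / 2) := by
  obtain ⟨X, hX, hTX⟩ := hT
  have hXm := hX.1
  have h := hX.lintegral_exp_norm_sq_le hd hS
  rw [show (3 : ENNReal) = ENNReal.ofReal 3 by simp, ← ENNReal.ofReal_mul (by norm_num)] at h
  refine ⟨?_, fun ω => ‖X ω‖, hXm.norm, fun ω => norm_nonneg _, fun ω => ?_,
    integrable_exp_of_lintegral_le (by fun_prop) h,
    integral_exp_le_of_lintegral_le (by fun_prop) (by positivity) h⟩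
  · rw [show T = fun ω => Tensor.power p (X ω) from funext hTX]
    exact Tensor.measurable_power.comp hXm
  · rw [hTX, ← Tensor.frobNorm_eq_norm_toLp, Tensor.frobNorm_power]

theorem measureReal_opNorm_ge_le {p d n : ℕ} (hp : 1 ≤ p) (hd : 1 ≤ d) (hn : 2 ≤ n)
    {S : Matrix (Fin d) (Fin d) ℝ} (hS : S.PosDef) {Ω : Type*} [MeasurableSpace Ω] {μ : Measure Ω}
    [IsProbabilityMeasure μ] {T : Fin n → Ω → Tensor p d} (hind : iIndepFun T μ)
    (hT : ∀ i, IsSymmRankOneSubgaussian S (T i) μ) {l : ℝ} (hl : 0 < l) :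
    μ.real {ω | 7 ^ p * (4 + 2 * p.factorial) * sigmaOne hS ^ p *
        √((effDim hS + Real.log d + l) ^ (p + 1) * Real.log n ^ p / n) ≤
      Tensor.opNorm (Tensor.empiricalMean T ω -
        Tensor.expectation μ (Tensor.empiricalMean T))} ≤ Real.exp (-l) := by
  have hσ := sigmaOne_pos hd hS
  have hDe := one_le_effDim hd hS
  choose hTm N hNm hN0 hTN hNi hNA using fun i => (hT i).exists_exp_bound hd hS
  set σ := sigmaOne hS
  set De := effDim hS
  have hn0 : (0 : ℝ) < n := by exact_mod_cast (by omega : 0 < n)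
  have hL0 : 0 < Real.log n := Real.log_pos (by exact_mod_cast hn)
  have hK1 : 1 ≤ De / 2 + Real.log n + l + Real.log 8 := by
    have h2 := Real.log_two_gt_d9
    have : Real.log 2 ≤ Real.log 8 := Real.log_le_log (by norm_num) (by norm_num)
    linarith
  have hdev := deviation_level_le (p := p) hn hσ hDe
    (D := De + Real.log d + l) (by linarith [Real.log_natCast_nonneg d]) hl.le
  have hexpK : Real.exp (-(De / 2 + Real.log n + l + Real.log 8)) =
      Real.exp (-l) / (8 * n * Real.exp (De / 2)) := by
    rw [show -(De / 2 + Real.log n + l + Real.log 8) =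
      -l - (Real.log 8 + Real.log n + De / 2) by ring, Real.exp_sub, Real.exp_add, Real.exp_add,
      Real.exp_log hn0, Real.exp_log (by norm_num)]
  set K := De / 2 + Real.log n + l + Real.log 8
  set R := √(8 * σ ^ 2 * K) with hR
  have hc : 0 < 8 * σ ^ 2 := by positivity
  have hR0 : 0 < R := Real.sqrt_pos.2 (by positivity)
  have hRK : R ^ 2 = 8 * σ ^ 2 * K := Real.sq_sqrt (by positivity)
  have hE : Real.exp (-l) ≤ 1 := Real.exp_le_one_iff.2 (by linarith)
  let T' : Fin n → Ω → EuclideanSpace ℝ (Fin p → Fin d) := fun i ω => WithLp.toLp 2 (T i ω)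
  have htoLp : Measurable (WithLp.toLp 2 : Tensor p d → EuclideanSpace ℝ (Fin p → Fin d)) := by
    fun_prop
  have hT'm (i : Fin n) : Measurable (T' i) := htoLp.comp (hTm i)
  have hT'i (i : Fin n) : Integrable (T' i) μ := by
    refine (integrable_norm_iff (hT'm i).aestronglyMeasurable).1 ?_
    simp only [T', hTN]
    exact integrable_pow_of_integrable_exp_sq (hNm i) (hN0 i) hc p (hNi i)
  have hset (i : Fin n) : {ω | R ^ p < ‖T' i ω‖} = {ω | R < N i ω} := by
    ext ω
    simp only [T', hTN, Set.mem_ofPred_eq]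
    exact pow_lt_pow_iff_left₀ hR0.le (hN0 i ω) (by omega)
  -- Here `q` is exactly `3 exp (De / 2) * exp (-K)`; the 2 in `β` dominates `3e/8`; and `r` is
  -- tuned so that the Hoeffding term equals `exp (-l) / 2`.
  have hmain := measureReal_norm_sum_sub_integral_ge_le (by omega) hT'm
    (hind.comp (fun _ => WithLp.toLp 2) fun _ => htoLp) hT'i (ρ := R ^ p)
    (q := 3 / (8 * n) * Real.exp (-l)) (β := R ^ p * p.factorial * (2 / n))
    (r := R ^ p * √(8 * n * (l + Real.log 4))) (by positivity) (by positivity)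
    (fun i => by
      rw [hset]
      refine (measureReal_lt_le_of_integral_exp_sq hc hR0.le hRK (hNi i) (hNA i)).trans
        (le_of_eq ?_)
      rw [hexpK]
      field_simp)
    (fun i => by
      rw [hset]
      simp only [T', hTN]
      refine (integral_indicator_pow_le hc hK1 hR0.le hRK p (hN0 i) (hNi i) (hNA i)).trans ?_
      rw [mul_assoc _ (Real.exp _)]
      refine mul_le_mul_of_nonneg_left ?_ (by positivity)
      rw [sub_eq_add_neg, Real.exp_add, hexpK, show Real.exp 1 * (Real.exp (-l) /
        (8 * n * Real.exp (De / 2))) * (3 * Real.exp (De / 2)) =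
        (3 / 8 * Real.exp 1 * Real.exp (-l)) / n by field_simp]
      gcongr
      nlinarith [Real.exp_one_lt_d9, Real.exp_pos (-l), Real.exp_pos 1])
  have hH : 2 * Real.exp (-((R ^ p * √(8 * n * (l + Real.log 4))) ^ 2 /
      (8 * n * (R ^ p) ^ 2))) = Real.exp (-l) / 2 := by
    have h4 : 0 < Real.log 4 := Real.log_pos (by norm_num)
    rw [mul_pow, Real.sq_sqrt (by positivity), show (R ^ p) ^ 2 * (8 * n * (l + Real.log 4)) /
      (8 * n * (R ^ p) ^ 2) = l + Real.log 4 by field_simp, neg_add, Real.exp_add, Real.exp_neg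
      (Real.log 4), Real.exp_log (by norm_num)]
    ring
  rw [hH] at hmain
  calc _ ≤ μ.real {ω | R ^ p * √(8 * n * (l + Real.log 4)) + n * (R ^ p * p.factorial * (2 / n)) ≤
        ‖∑ i, (T' i ω - ∫ ω, T' i ω ∂μ)‖} := by
        refine measureReal_mono fun ω hω => ?_
        have h1 := hdev.trans (le_trans hω (Tensor.opNorm_le_frobNorm _))
        rw [Tensor.frobNorm_empiricalMean_sub_expectation hT'i] at h1
        exact le_of_mul_le_mul_left h1 (by positivity)
    _ ≤ _ := hmain
    _ ≤ Real.exp (-l) := by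
        -- The failure probabilities add up to `3/8 + 1/2 < 1` times `exp (-l)`.
        rw [show n * (3 / (8 * n) * Real.exp (-l)) = 3 / 8 * Real.exp (-l) by field_simp]
        linarith [Real.exp_pos (-l)]

theorem theorem3 (p : ℕ) (hp : 1 ≤ p) :
    ∃ C : ℝ, 0 < C ∧
      ∀ (d n : ℕ), 1 ≤ d → 2 ≤ n →
      ∀ (S : Matrix (Fin d) (Fin d) ℝ) (hS : S.PosDef)
        (Ω : Type*) [MeasurableSpace Ω] (μ : Measure Ω) [IsProbabilityMeasure μ]
        (T : Fin n → Ω → Tensor p d),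
        iIndepFun T μ →
        (∀ i j, IdentDistrib (T i) (T j) μ μ) →
        (∀ i, IsSymmRankOneSubgaussian S (T i) μ) →
        (∀ i J, Integrable (fun ω => T i ω J) μ) ∧
        (∀ δ : ℝ, 0 < δ →
          1 - δ ≤ μ.real {ω |
            Tensor.opNorm (Tensor.empiricalMean T ω -
                Tensor.expectation μ (Tensor.empiricalMean T)) ≤
              C * sigmaOne hS ^ p *
                Real.sqrt ((effDim hS + Real.log d + Real.log δ⁻¹) ^ (p + 1) *
                  Real.log n ^ p / n)}) ∧
        (∀ l : ℝ, 0 < l →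
          μ.real {ω |
            C * sigmaOne hS ^ p *
                Real.sqrt ((effDim hS + Real.log d + l) ^ (p + 1) * Real.log n ^ p / n) ≤
              Tensor.opNorm (Tensor.empiricalMean T ω -
                Tensor.expectation μ (Tensor.empiricalMean T))} ≤
            Real.exp (-l)) := by
  refine ⟨7 ^ p * (4 + 2 * p.factorial), by positivity, ?_⟩
  intro d n hd hn S hS Ω _ μ _ T hind _ hT
  refine ⟨fun i J => ?_, fun δ hδ => ?_,
    fun l hl => measureReal_opNorm_ge_le hp hd hn hS hind hT hl⟩
  · obtain ⟨hTm, N, hNm, hN0, hTN, hNi, -⟩ := (hT i).exists_exp_bound hd hS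
    have hσ := sigmaOne_pos hd hS
    refine (integrable_pow_of_integrable_exp_sq hNm hN0 (by positivity) p hNi).mono'
      ((measurable_pi_apply J).comp hTm).aestronglyMeasurable (.of_forall fun ω => ?_)
    rw [← hTN]
    exact PiLp.norm_apply_le (WithLp.toLp 2 (T i ω)) J
  · rcases le_or_gt 1 δ with h1 | h1
    · exact (sub_nonpos.2 h1).trans measureReal_nonneg
    · have h := measureReal_opNorm_ge_le hp hd hn hS hind hT
        (Real.log_pos ((one_lt_inv₀ hδ).2 h1))
      rw [Real.log_inv, neg_neg, Real.exp_log hδ, ← Real.log_inv] at h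
      -- With `l = log δ⁻¹`, the events "at most the level" and "at least the level" cover the whole
      -- space, and the second has probability at most `δ`.
      rw [sub_le_iff_le_add]
      refine le_trans ?_ (add_le_add_right h _)
      refine le_trans (le_of_eq (by simp)) ((measureReal_mono (μ := μ) (s₁ := Set.univ)
        fun ω _ => ?_).trans (measureReal_union_le _ _))
      exact le_total (Tensor.opNorm (Tensor.empiricalMean T ω -
        Tensor.expectation μ (Tensor.empiricalMean T))) _
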